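/- Let $q\ge 2$ and $r\ge 0$ be integers, let $\{X_n\}_{n\ge1}$ be a stochastic process with values in $\{0,\dots,q-1\}$, and let $\Pi$ be a random element of a measurable space $(E,\mathcal A)$ defined on the same probability space. Let $\kappa$ be a regular conditional distribution of $\{X_n\}_{n\ge1}$ given $\Pi$, that is, a probability kernel from $E$ to $\{0,\dots,q-1\}^{\mathbb N}$ such that the joint law of $(\Pi,\{X_n\}_{n\ge1})$ is $\mathrm P(\Pi\in d\pi)\,\kappa(\pi,ds)$. Suppose that $\{X_n\}_{n\ge1}$ conditioned on $\Pi$ is a stationary Markov chain of order $r$, i.e. that almost surely a sequence with law $\kappa(\Pi,\cdot)$ is stationary and is a Markov chain of order $r$ (for every $n>r$, its $n$-th entry conditioned on the entries $1,\dots,n-1$ depends only on the $r$ entries $n-r,\dots,n-1$; for $r=0$ the entries are independent). Put $X=\sum_{n=1}^\infty X_nq^{-n}\in[0,1]$ and, for $x\in\mathbb R$, $F(x)=\mathrm P(X\le x)$ and $$F_\pi(x)=\mathrm P(X\le x\mid \Pi=\pi)=\kappa\Big(\pi,\Big\{s:\sum_{n=1}^\infty s_nq^{-n}\le x\Big\}\Big),\qquad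 \pi\in E .$$ Then $F=\mathrm E F_\Pi$. Let $F_1(x)=\max(0,\min(x,1))$ be the CDF of the uniform distribution on $[0,1]$. Call a function $G:\mathbb R\to\mathbb R$ strictly increasing at $x$ if $G(s)<G(t)$ whenever $s<x<t$, and for $x\in[0,1]$ let $$A_x=\{\pi\in E: F_\pi\text{ is discontinuous at }x\},\qquad B_x=\{\pi\in E: F_\pi\text{ is strictly increasing at }x\}.$$ Then: (I) for every $x\in[0,1]$, $F$ is discontinuous at $x$ if and only if $\mathrm P(\Pi\in A_x)>0$; (II) for every $x\in[0,1]$, $F$ is strictly increasing at $x$ if and only if $\mathrm P(\Pi\in B_x)>0$; (III) for Lebesgue-almost every $x\in[0,1]$, $F$ is differentiable at $x$ and $F'(x)=\mathrm P(F_\Pi=F_1)$. -/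

import Mathlib

open MeasureTheory ProbabilityTheory

/-- A law on digit sequences (the entry with index `n` is the digit number `n + 1`) is stationary
if dropping the first digit does not change it. -/
def IsStationaryLaw {q : ℕ} (μ : Measure (ℕ → Fin q)) : Prop :=
  μ.map (fun s n => s (n + 1)) = μ

/-- A law on digit sequences is that of a Markov chain of order `r`: for every `n ≥ r`, the
conditional distribution of the digit with index `n` given all the previous digits
`x 0, …, x (n - 1)` is its conditional distribution given the last `r` of them. It is required for
all `x` for which the conditioning event has positive probability. For `r = 0` the second
conditioning event is the sure event, so that the digits are independent. -/
def IsMarkovLaw {q : ℕ} (r : ℕ) (μ : Measure (ℕ → Fin q)) : Prop :=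
  ∀ n : ℕ, r ≤ n → ∀ x : ℕ → Fin q, μ {s | ∀ i < n, s i = x i} ≠ 0 →
    μ[{s | s n = x n} | {s | ∀ i < n, s i = x i}] =
      μ[{s | s n = x n} | {s | ∀ i, n - r ≤ i → i < n → s i = x i}]

/-- The cumulative distribution function of the number `(0.s₀s₁s₂…)_q` when the sequence of digits
has law `μ`. -/
noncomputable def digitCDF {q : ℕ} (μ : Measure (ℕ → Fin q)) (x : ℝ) : ℝ :=
  μ.real {s | Real.ofDigits s ≤ x}

/-- The cumulative distribution function of the uniform distribution on `[0, 1]`. -/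
noncomputable def uniformCDF (x : ℝ) : ℝ := max 0 (min x 1)

/-- `F` is strictly increasing at the point `x`. -/
def StrictlyIncreasingAt (F : ℝ → ℝ) (x : ℝ) : Prop :=
  ∀ s t : ℝ, s < x → x < t → F s < F t

/-!
Write `ν` for the law of the digits; it is the mixture `∫ κ (Z ω) dP`, so `F` is the distribution
function of the image of `ν` under `Real.ofDigits`, and a measurable set of sequences is `ν`-null
iff it is `κ (Z ω)`-null for almost every `ω`. Continuity of a distribution function at `x` means
that the fibre over `x` is null, which gives the criterion for discontinuity.

A distribution function is strictly increasing at `x` iff all balls around `x` are charged. A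
mixture could charge all of them although almost no component does; this is excluded because the
support of a stationary Markov law of order `r` is determined by the finite set of words of length
`r + 1` which it charges (`measure_open_ne_zero_of_chargedWords_eq`). So one ball is null for all
the laws that are not strictly increasing at `x` (`exists_ball_null`).

For the derivative, consider the normal sequences, in which the words of each length have the
frequencies expected under the uniform law. They have full measure under the uniform law, by the
strong law of large numbers. If a stationary law `μ` charges them, its mean word frequencies show
that it dominates a multiple of the uniform law on words (`IsStationaryLaw.le_wordMass`). If `μ` is
also Markov, the average over all words `w` of length `n` of `log (q ^ n * μ w)` is then bounded
below. From `n = r` on it grows linearly, with a slope that is negative, by the strict concavity of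
the logarithm, unless all transition probabilities are `1 / q`; so `μ` is uniform
(`IsMarkovLaw.wordMass_eq_of_le`, `IsMarkovLaw.eq_uniformLaw`). Hence the components that are not
uniform all live on the sequences which are not normal. These represent a single Lebesgue null set
of numbers, so the mixture of these components, uncountable as it may be, is singular. Lebesgue's
theorem on the differentiation of measures gives the derivative
(`ae_hasDerivAt_digitCDF_mixture`).
-/

/-! ### Cylinders -/

/-- Dropping the first `k` digits of a sequence. -/
def dropDigits {q : ℕ} (k : ℕ) (s : ℕ → Fin q) : ℕ → Fin q := fun i => s (i + k)

lemma measurable_dropDigits {q : ℕ} (k : ℕ) : Measurable (dropDigits (q := q) k) := by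
  unfold dropDigits; fun_prop

lemma measurableSet_cylinder {q : ℕ} (x : ℕ → Fin q) (n : ℕ) :
    MeasurableSet (PiNat.cylinder x n) :=
  (PiNat.isOpen_cylinder _ x n).measurableSet

/-- The mass which `μ` gives to the sequences that begin with the word `w`. -/
noncomputable def wordMass {q n : ℕ} (μ : Measure (ℕ → Fin q)) (w : Fin n → Fin q) : ℝ :=
  μ.real {s | ∀ i : Fin n, s i = w i}

lemma measurableSet_word {q n : ℕ} (w : Fin n → Fin q) :
    MeasurableSet {s : ℕ → Fin q | ∀ i : Fin n, s i = w i} := by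
  have : {s : ℕ → Fin q | ∀ i : Fin n, s i = w i} = (fun s (i : Fin n) => s i) ⁻¹' {w} := by
    ext s; simp [funext_iff]
  rw [this]
  exact (by fun_prop : Measurable fun (s : ℕ → Fin q) (i : Fin n) => s i)
    (measurableSet_singleton w)

lemma wordMass_eq_cylinder {q n : ℕ} (μ : Measure (ℕ → Fin q)) {w : Fin n → Fin q}
    {x : ℕ → Fin q} (h : ∀ i : Fin n, x i = w i) : wordMass μ w = μ.real (PiNat.cylinder x n) := by
  unfold wordMass
  congr 1
  ext s
  simp only [Set.mem_ofPred_eq, PiNat.mem_cylinder_iff]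
  exact ⟨fun hs i hi => by rw [hs ⟨i, hi⟩, ← h ⟨i, hi⟩], fun hs i => by rw [hs i i.2, h i]⟩

lemma exists_extends {q n : ℕ} (hq : 0 < q) (w : Fin n → Fin q) :
    ∃ x : ℕ → Fin q, ∀ i : Fin n, x i = w i :=
  ⟨fun i => if h : i < n then w ⟨i, h⟩ else ⟨0, hq⟩, fun i => by simp⟩

lemma sum_wordMass_snoc {q n : ℕ} (μ : Measure (ℕ → Fin q)) [IsFiniteMeasure μ]
    (w : Fin n → Fin q) :
    ∑ b, wordMass μ (Fin.snoc (α := fun _ => Fin q) w b) = wordMass μ w := by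
  unfold wordMass
  rw [← measureReal_biUnion_finset]
  · congr 1
    ext s
    simp [Fin.forall_fin_succ']
  · intro a _ b _ hab
    simp only [Function.onFun, Set.disjoint_left, Set.mem_ofPred_eq]
    intro s h1 h2
    have h1 := h1 (Fin.last n)
    have h2 := h2 (Fin.last n)
    simp only [Fin.snoc_last] at h1 h2
    exact hab (h1.symm.trans h2)
  · exact fun b _ => measurableSet_word _

lemma sum_wordMass {q n : ℕ} (μ : Measure (ℕ → Fin q)) [IsProbabilityMeasure μ] :
    ∑ w : Fin n → Fin q, wordMass μ w = 1 := by
  unfold wordMass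
  rw [← measureReal_biUnion_finset]
  · rw [← probReal_univ (μ := μ)]
    congr 1
    ext s
    simp only [Finset.mem_univ, Set.iUnion_true, Set.mem_iUnion, Set.mem_ofPred_eq, Set.mem_univ,
      iff_true]
    exact ⟨fun i => s i, fun i => rfl⟩
  · intro a _ b _ hab
    simp only [Function.onFun, Set.disjoint_left, Set.mem_ofPred_eq]
    exact fun s h1 h2 => hab (funext fun i => (h1 i).symm.trans (h2 i))
  · exact fun b _ => measurableSet_word _

/-- Two probability laws on digit sequences which agree on cylinders are equal. -/
lemma ext_of_cylinder {q : ℕ} {μ ν : Measure (ℕ → Fin q)} [IsProbabilityMeasure μ]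
    [IsProbabilityMeasure ν]
    (h : ∀ x n, μ (PiNat.cylinder x n) = ν (PiNat.cylinder x n)) : μ = ν := by
  refine ext_of_generate_finite {s : Set (ℕ → Fin q) | ∃ x n, s = PiNat.cylinder x n} ?_ ?_ ?_
    (by simp)
  · rw [← (PiNat.isTopologicalBasis_cylinders (E := fun _ : ℕ => Fin q)).borel_eq_generateFrom]
    exact BorelSpace.measurable_eq
  · rintro _ ⟨x, n, rfl⟩ _ ⟨y, m, rfl⟩ ⟨z, hz1, hz2⟩
    refine ⟨z, max n m, ?_⟩
    rw [← PiNat.mem_cylinder_iff_eq.1 hz1, ← PiNat.mem_cylinder_iff_eq.1 hz2]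
    ext s
    simp only [Set.mem_inter_iff, PiNat.mem_cylinder_iff, lt_max_iff]
    exact ⟨fun h i hi => hi.elim (h.1 i) (h.2 i), fun h => ⟨fun i hi => h i (.inl hi),
      fun i hi => h i (.inr hi)⟩⟩
  · rintro _ ⟨x, n, rfl⟩
    exact h x n

/-! ### Stationary Markov laws -/

section Stationary

variable {q : ℕ} {μ : Measure (ℕ → Fin q)}

lemma IsStationaryLaw.measurePreserving (hμ : IsStationaryLaw μ) (k : ℕ) :
    MeasurePreserving (dropDigits k) μ μ := by
  induction k with
  | zero => exact MeasurePreserving.id μ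
  | succ k ih =>
    have h1 : MeasurePreserving (dropDigits 1) μ μ := ⟨measurable_dropDigits 1, hμ⟩
    have := h1.comp ih
    convert this using 1
    ext s i
    simp only [dropDigits, Function.comp]
    congr 2; omega

lemma sum_wordMass_cons [IsFiniteMeasure μ] (hμ : IsStationaryLaw μ) {n : ℕ} (w : Fin n → Fin q) :
    ∑ b, wordMass μ (Fin.cons (α := fun _ => Fin q) b w) = wordMass μ w := by
  unfold wordMass
  rw [← (hμ.measurePreserving 1).measureReal_preimage (measurableSet_word w).nullMeasurableSet,
    ← measureReal_biUnion_finset]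
  · congr 1
    ext s
    simp [Fin.forall_fin_succ, dropDigits]
  · intro a _ b _ hab
    simp only [Function.onFun, Set.disjoint_left, Set.mem_ofPred_eq]
    intro s h1 h2
    have h1 := h1 0
    have h2 := h2 0
    simp only [Fin.cons_zero] at h1 h2
    exact hab (h1.symm.trans h2)
  · exact fun b _ => measurableSet_word _

/-- The Markov property as a product rule, with the windows of length `r` and `r + 1` moved to the
beginning by stationarity. -/
lemma IsMarkovLaw.mul_eq_mul [IsProbabilityMeasure μ] (hs : IsStationaryLaw μ) {r : ℕ}
    (hm : IsMarkovLaw r μ) {n : ℕ} (hn : r ≤ n) (x : ℕ → Fin q)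
    (h0 : μ.real (PiNat.cylinder x n) ≠ 0) :
    μ.real (PiNat.cylinder x (n + 1)) * μ.real (PiNat.cylinder (dropDigits (n - r) x) r) =
      μ.real (PiNat.cylinder x n) * μ.real (PiNat.cylinder (dropDigits (n - r) x) (r + 1)) := by
  have hx0 : μ {s | ∀ i < n, s i = x i} ≠ 0 := fun h => h0 (by
    rw [measureReal_def]; erw [h]; rfl)
  have key := hm n hn x hx0
  have hA : {s : ℕ → Fin q | ∀ i < n, s i = x i} = PiNat.cylinder x n := rfl
  have hB : {s : ℕ → Fin q | ∀ i, n - r ≤ i → i < n → s i = x i} =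
      dropDigits (n - r) ⁻¹' PiNat.cylinder (dropDigits (n - r) x) r := by
    ext s
    simp only [Set.mem_ofPred_eq, Set.mem_preimage, PiNat.mem_cylinder_iff, dropDigits]
    refine ⟨fun h i hi => h _ (by omega) (by omega), fun h i h1 h2 => ?_⟩
    have := h (i - (n - r)) (by omega)
    rwa [Nat.sub_add_cancel h1] at this
  have hAn : PiNat.cylinder x n ∩ {s | s n = x n} = PiNat.cylinder x (n + 1) := by
    ext s
    simp only [Set.mem_inter_iff, PiNat.mem_cylinder_iff, Set.mem_ofPred_eq,
      Nat.forall_lt_succ_right]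
  have hBn : dropDigits (n - r) ⁻¹' PiNat.cylinder (dropDigits (n - r) x) r ∩ {s | s n = x n} =
      dropDigits (n - r) ⁻¹' PiNat.cylinder (dropDigits (n - r) x) (r + 1) := by
    ext s
    have : r + (n - r) = n := by omega
    simp only [Set.mem_inter_iff, Set.mem_preimage, PiNat.mem_cylinder_iff, Set.mem_ofPred_eq,
      Nat.forall_lt_succ_right, dropDigits, this]
  rw [hA, hB] at key
  have hBm := (measurable_dropDigits (n - r))
    (measurableSet_cylinder (dropDigits (n - r) x) r)
  have key := congrArg ENNReal.toReal key
  rw [cond_apply (measurableSet_cylinder x n), cond_apply hBm, hAn, hBn, ENNReal.toReal_mul,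
    ENNReal.toReal_mul, ENNReal.toReal_inv, ENNReal.toReal_inv, ← measureReal_def,
    ← measureReal_def, ← measureReal_def, ← measureReal_def,
    (hs.measurePreserving _).measureReal_preimage (measurableSet_cylinder _ _).nullMeasurableSet,
    (hs.measurePreserving _).measureReal_preimage (measurableSet_cylinder _ _).nullMeasurableSet]
    at key
  have hr0 : μ.real (PiNat.cylinder (dropDigits (n - r) x) r) ≠ 0 := by
    rw [← (hs.measurePreserving (n - r)).measureReal_preimage
      (measurableSet_cylinder _ _).nullMeasurableSet]
    have : μ.real (PiNat.cylinder x n) ≤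
        μ.real (dropDigits (n - r) ⁻¹' PiNat.cylinder (dropDigits (n - r) x) r) := by
      refine measureReal_mono fun s h => ?_
      simp only [Set.mem_preimage, PiNat.mem_cylinder_iff, dropDigits] at h ⊢
      exact fun i hi => h _ (by omega)
    exact (((measureReal_nonneg).lt_of_ne h0.symm).trans_le this).ne'
  field_simp at key
  linarith

end Stationary

/-! ### The support of a stationary Markov law -/

section Support

variable {q : ℕ}

/-- An open set is charged iff it contains a point all of whose cylinders are charged. -/
lemma measure_open_ne_zero_iff (μ : Measure (ℕ → Fin q)) [IsProbabilityMeasure μ]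
    {U : Set (ℕ → Fin q)} (hU : IsOpen U) :
    μ U ≠ 0 ↔ ∃ x ∈ U, ∀ n, μ.real (PiNat.cylinder x n) ≠ 0 := by
  constructor
  · intro h
    obtain ⟨x, hx, hpos⟩ := exists_mem_forall_mem_nhdsWithin_pos_measure h
    refine ⟨x, hx, fun n => ?_⟩
    have := hpos (PiNat.cylinder x n) (mem_nhdsWithin_of_mem_nhds
      ((PiNat.isOpen_cylinder _ x n).mem_nhds (PiNat.self_mem_cylinder x n)))
    exact (measureReal_ne_zero_iff (by finiteness)).2 this.ne'
  · rintro ⟨x, hx, h⟩ h0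
    obtain ⟨_, ⟨y, n, rfl⟩, hxy, hsub⟩ :=
      (PiNat.isTopologicalBasis_cylinders (E := fun _ : ℕ => Fin q)).exists_subset_of_mem_open hx hU
    rw [← PiNat.mem_cylinder_iff_eq.1 hxy] at hsub
    exact h n (by rw [measureReal_def, measure_mono_null hsub h0]; rfl)

/-- Under a stationary Markov law of order `r`, a sequence belongs to the support as soon as all its
windows of length `r + 1` are charged. -/
lemma cylinder_pos_iff {μ : Measure (ℕ → Fin q)} [IsProbabilityMeasure μ]
    (hs : IsStationaryLaw μ) {r : ℕ} (hm : IsMarkovLaw r μ) (x : ℕ → Fin q) :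
    (∀ n, μ.real (PiNat.cylinder x n) ≠ 0) ↔
      ∀ j, μ.real (PiNat.cylinder (dropDigits j x) (r + 1)) ≠ 0 := by
  constructor
  · intro h j
    have h1 : μ.real (PiNat.cylinder x (r + 1 + j)) ≤
        μ.real (dropDigits j ⁻¹' PiNat.cylinder (dropDigits j x) (r + 1)) := by
      refine measureReal_mono fun s hs => ?_
      simp only [Set.mem_preimage, PiNat.mem_cylinder_iff, dropDigits] at hs ⊢
      exact fun i hi => hs _ (by omega)
    rw [(hs.measurePreserving j).measureReal_preimage
      (measurableSet_cylinder _ _).nullMeasurableSet] at h1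
    exact ((measureReal_nonneg.lt_of_ne (h _).symm).trans_le h1).ne'
  · intro h n
    have hr : ∀ k ≤ r + 1, μ.real (PiNat.cylinder x k) ≠ 0 := fun k hk =>
      ((measureReal_nonneg.lt_of_ne (h 0).symm).trans_le
        (measureReal_mono (PiNat.cylinder_anti x hk))).ne'
    rcases le_total n r with hn | hn
    · exact hr n (by omega)
    induction n, hn using Nat.le_induction with
    | base => exact hr r (by omega)
    | succ n hn ih =>
      intro h0
      have := hm.mul_eq_mul hs hn x ih
      rw [h0, zero_mul] at this
      exact (mul_ne_zero ih (h _)) this.symm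

/-- The charged words of length `r + 1`. They determine the support of a stationary Markov law of
order `r`. -/
def chargedWords (r : ℕ) (μ : Measure (ℕ → Fin q)) : Set (Fin (r + 1) → Fin q) :=
  {w | wordMass μ w ≠ 0}

lemma measure_open_ne_zero_of_chargedWords_eq {r : ℕ} {μ ν : Measure (ℕ → Fin q)}
    [IsProbabilityMeasure μ] [IsProbabilityMeasure ν]
    (hμ : IsStationaryLaw μ ∧ IsMarkovLaw r μ) (hν : IsStationaryLaw ν ∧ IsMarkovLaw r ν)
    (h : chargedWords r μ = chargedWords r ν) {U : Set (ℕ → Fin q)} (hU : IsOpen U)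
    (h0 : μ U ≠ 0) : ν U ≠ 0 := by
  rw [measure_open_ne_zero_iff _ hU] at h0 ⊢
  obtain ⟨x, hx, hpos⟩ := h0
  refine ⟨x, hx, (cylinder_pos_iff hν.1 hν.2 x).2 fun j => ?_⟩
  have := (cylinder_pos_iff hμ.1 hμ.2 x).1 hpos j
  rw [← wordMass_eq_cylinder (w := fun i : Fin (r + 1) => dropDigits j x i) _ (fun _ => rfl)]
    at this ⊢
  exact h.subset this

end Support

/-! ### Distribution functions -/

section CDF

variable {q : ℕ}

lemma measurable_ofDigits : Measurable (Real.ofDigits (b := q)) :=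
  Real.continuous_ofDigits.measurable

instance isProbabilityMeasure_map_ofDigits (μ : Measure (ℕ → Fin q)) [IsProbabilityMeasure μ] :
    IsProbabilityMeasure (μ.map Real.ofDigits) :=
  Measure.isProbabilityMeasure_map measurable_ofDigits.aemeasurable

lemma digitCDF_eq_cdf (μ : Measure (ℕ → Fin q)) [IsProbabilityMeasure μ] :
    digitCDF μ = cdf (μ.map Real.ofDigits) := by
  ext x
  rw [cdf_eq_real, map_measureReal_apply measurable_ofDigits measurableSet_Iic]
  rfl

lemma continuousAt_cdf_iff (ρ : Measure ℝ) [IsProbabilityMeasure ρ] (x : ℝ) :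
    ContinuousAt (cdf ρ) x ↔ ρ {x} = 0 := by
  rw [(cdf ρ).mono.continuousAt_iff_leftLim_eq_rightLim, StieltjesFunction.rightLim_eq]
  conv_rhs => rw [← measure_cdf ρ, StieltjesFunction.measure_singleton, ENNReal.ofReal_eq_zero]
  have := (cdf ρ).mono.leftLim_le (le_refl x)
  constructor
  · intro h; linarith
  · intro h; linarith

lemma continuousAt_digitCDF_iff (μ : Measure (ℕ → Fin q)) [IsProbabilityMeasure μ] (x : ℝ) :
    ContinuousAt (digitCDF μ) x ↔ μ (Real.ofDigits ⁻¹' {x}) = 0 := by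
  rw [digitCDF_eq_cdf, continuousAt_cdf_iff,
    Measure.map_apply measurable_ofDigits (measurableSet_singleton x)]

lemma strictlyIncreasingAt_cdf_iff (ρ : Measure ℝ) [IsProbabilityMeasure ρ] (x : ℝ) :
    StrictlyIncreasingAt (cdf ρ) x ↔
      ∀ k : ℕ, ρ (Metric.ball x (1 / (k + 1))) ≠ 0 := by
  have key : ∀ s t, s < t → (cdf ρ s < cdf ρ t ↔ ρ (Set.Ioc s t) ≠ 0) := by
    intro s t hst
    conv_rhs => rw [← measure_cdf ρ, StieltjesFunction.measure_Ioc, Ne, ENNReal.ofReal_eq_zero]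
    rw [not_le, sub_pos]
  constructor
  · intro h k h0
    have hk : (0 : ℝ) < 1 / (k + 1) := by positivity
    refine (key (x - 1 / (k + 1) / 2) (x + 1 / (k + 1) / 2) (by linarith)).1
      (h _ _ (by linarith) (by linarith)) (measure_mono_null ?_ h0)
    intro y hy
    rw [Real.ball_eq_Ioo]
    exact ⟨by linarith [hy.1], by linarith [hy.2]⟩
  · intro h s t hs ht
    obtain ⟨k, hk⟩ := exists_nat_one_div_lt (lt_min (sub_pos.2 hs) (sub_pos.2 ht))
    refine (key s t (hs.trans ht)).2 fun h0 => h k (measure_mono_null ?_ h0)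
    intro y hy
    rw [Real.ball_eq_Ioo] at hy
    rw [lt_min_iff] at hk
    exact ⟨by linarith [hy.1], by linarith [hy.2]⟩

lemma strictlyIncreasingAt_digitCDF_iff (μ : Measure (ℕ → Fin q)) [IsProbabilityMeasure μ]
    (x : ℝ) : StrictlyIncreasingAt (digitCDF μ) x ↔
      ∀ k : ℕ, μ (Real.ofDigits ⁻¹' Metric.ball x (1 / (k + 1))) ≠ 0 := by
  rw [digitCDF_eq_cdf, strictlyIncreasingAt_cdf_iff]
  simp_rw [Measure.map_apply measurable_ofDigits Metric.isOpen_ball.measurableSet]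

/-- Among stationary Markov laws of order `r` under which a neighbourhood of `x` is not charged,
there are only finitely many supports, so one neighbourhood of `x` serves all of them. -/
lemma exists_ball_null (r : ℕ) (x : ℝ) : ∃ K : ℕ, ∀ μ : Measure (ℕ → Fin q),
    IsProbabilityMeasure μ → IsStationaryLaw μ ∧ IsMarkovLaw r μ →
    ¬ StrictlyIncreasingAt (digitCDF μ) x →
    μ (Real.ofDigits ⁻¹' Metric.ball x (1 / (K + 1))) = 0 := by
  have hopen : ∀ k : ℕ, IsOpen (Real.ofDigits (b := q) ⁻¹' Metric.ball x (1 / (k + 1))) :=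
    fun k => Metric.isOpen_ball.preimage Real.continuous_ofDigits
  have h : ∀ S : Set (Fin (r + 1) → Fin q), ∃ k : ℕ, ∀ μ : Measure (ℕ → Fin q),
      IsProbabilityMeasure μ → IsStationaryLaw μ ∧ IsMarkovLaw r μ → chargedWords r μ = S →
      ¬ StrictlyIncreasingAt (digitCDF μ) x →
      μ (Real.ofDigits ⁻¹' Metric.ball x (1 / (k + 1))) = 0 := by
    intro S
    by_cases hS : ∃ μ : Measure (ℕ → Fin q), IsProbabilityMeasure μ ∧
        (IsStationaryLaw μ ∧ IsMarkovLaw r μ) ∧ chargedWords r μ = S ∧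
        ¬ StrictlyIncreasingAt (digitCDF μ) x
    · obtain ⟨μ, hμ, hμm, hμS, hμx⟩ := hS
      rw [strictlyIncreasingAt_digitCDF_iff] at hμx
      push Not at hμx
      obtain ⟨k, hk⟩ := hμx
      refine ⟨k, fun ν hν hνm hνS _ => ?_⟩
      by_contra h0
      exact measure_open_ne_zero_of_chargedWords_eq hνm hμm (hνS.trans hμS.symm) (hopen k) h0 hk
    · push Not at hS
      exact ⟨0, fun μ h1 h2 h3 h4 => absurd (hS μ h1 h2 h3) h4⟩
  choose k hk using h
  obtain ⟨K, hK⟩ := (Set.finite_range k).bddAbove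
  refine ⟨K, fun μ h1 h2 h3 => measure_mono_null (Set.preimage_mono (Metric.ball_subset_ball ?_))
    (hk _ μ h1 h2 rfl h3)⟩
  have : k (chargedWords r μ) ≤ K := hK ⟨_, rfl⟩
  have : (k (chargedWords r μ) : ℝ) ≤ K := by exact_mod_cast this
  gcongr

end CDF

/-! ### Stationary Markov laws dominating a multiple of the uniform law -/

section Uniform

variable {q : ℕ} {μ : Measure (ℕ → Fin q)}

lemma sum_words_snoc {n : ℕ} (f : (Fin (n + 1) → Fin q) → ℝ) :
    ∑ w, f w = ∑ v : Fin n → Fin q, ∑ b, f (Fin.snoc (α := fun _ => Fin q) v b) := by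
  rw [← (Fin.snocEquiv fun _ : Fin (n + 1) => Fin q).sum_comp, Fintype.sum_prod_type_right]
  rfl

lemma sum_words_cons {n : ℕ} (f : (Fin (n + 1) → Fin q) → ℝ) :
    ∑ w, f w = ∑ a, ∑ v : Fin n → Fin q, f (Fin.cons (α := fun _ => Fin q) a v) := by
  rw [← (Fin.consEquiv fun _ : Fin (n + 1) => Fin q).sum_comp, Fintype.sum_prod_type]
  rfl

/-- From length `r` on, the conditional law of the next digit is not affected by adding a digit at
the beginning of the word. -/
lemma IsMarkovLaw.wordMass_snoc_cons [IsProbabilityMeasure μ] (hs : IsStationaryLaw μ) {r : ℕ}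
    (hm : IsMarkovLaw r μ) (hpos : ∀ n, ∀ w : Fin n → Fin q, 0 < wordMass μ w) {n : ℕ} (hn : r ≤ n)
    (v : Fin n → Fin q) (a b : Fin q) :
    wordMass μ (Fin.snoc (α := fun _ => Fin q) (Fin.cons (α := fun _ => Fin q) a v) b) *
      wordMass μ v = wordMass μ (Fin.cons (α := fun _ => Fin q) a v) *
        wordMass μ (Fin.snoc (α := fun _ => Fin q) v b) := by
  have hposc : ∀ (x : ℕ → Fin q) (n : ℕ), μ.real (PiNat.cylinder x n) ≠ 0 := fun x n => by
    rw [← wordMass_eq_cylinder (w := fun i : Fin n => x i) μ fun _ => rfl]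
    exact (hpos _ _).ne'
  obtain ⟨x, hx⟩ := exists_extends a.pos
    (Fin.snoc (α := fun _ => Fin q) (Fin.cons (α := fun _ => Fin q) a v) b)
  have hx' : ∀ i : Fin (n + 1), x i = Fin.cons (α := fun _ => Fin q) a v i := fun i => by
    have := hx i.castSucc
    rwa [Fin.snoc_castSucc] at this
  have hy : ∀ i : Fin (n + 1), dropDigits 1 x i = Fin.snoc (α := fun _ => Fin q) v b i := fun i => by
    have := hx i.succ
    rwa [← Fin.cons_snoc_eq_snoc_cons, Fin.cons_succ] at this
  have hy' : ∀ i : Fin n, dropDigits 1 x i = v i := fun i => by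
    have := hx' i.succ
    rwa [Fin.cons_succ] at this
  rw [wordMass_eq_cylinder μ hx, wordMass_eq_cylinder μ hx', wordMass_eq_cylinder μ hy,
    wordMass_eq_cylinder μ hy']
  have h1 := hm.mul_eq_mul hs (n := n + 1) (by omega) x (hposc _ _)
  have h2 := hm.mul_eq_mul hs hn (dropDigits 1 x) (hposc _ _)
  have hd : dropDigits (n - r) (dropDigits 1 x) = dropDigits (n + 1 - r) x := by
    ext i
    simp only [dropDigits]
    congr 2; omega
  rw [hd] at h2
  have h3 := hposc (dropDigits (n + 1 - r) x) r
  have h4 := hposc (dropDigits (n + 1 - r) x) (r + 1)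
  set z := dropDigits (n + 1 - r) x
  apply mul_right_cancel₀ h4
  apply mul_right_cancel₀ h3
  linear_combination (μ.real (PiNat.cylinder (dropDigits 1 x) n) *
    μ.real (PiNat.cylinder z (r + 1))) * h1 - μ.real (PiNat.cylinder x (n + 1)) *
    μ.real (PiNat.cylinder z (r + 1)) * h2

/-- A stationary Markov law which dominates a positive multiple of the uniform law on words is
uniform. The average over the words `w` of length `n` of `log (q ^ n * μ w)` is bounded below; its
increments do not depend on `n` from `n = r` on, and they are averages of logarithms of numbers of
mean `1`, so they are negative unless all these numbers are `1`. -/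
lemma IsMarkovLaw.wordMass_eq_of_le [IsProbabilityMeasure μ] (hs : IsStationaryLaw μ) {r : ℕ}
    (hm : IsMarkovLaw r μ) (hq : 0 < q) {c : ℝ} (hc : 0 < c)
    (hlow : ∀ n, ∀ w : Fin n → Fin q, c * ((q : ℝ) ^ n)⁻¹ ≤ wordMass μ w) (n : ℕ)
    (w : Fin n → Fin q) : wordMass μ w = ((q : ℝ) ^ n)⁻¹ := by
  have hq' : (0 : ℝ) < q := by exact_mod_cast hq
  have hpos : ∀ n, ∀ w : Fin n → Fin q, 0 < wordMass μ w := fun n w =>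
    lt_of_lt_of_le (by positivity) (hlow n w)
  -- the relative transition probabilities
  let ρ : ∀ n, (Fin n → Fin q) → Fin q → ℝ := fun n v b =>
    q * wordMass μ (Fin.snoc (α := fun _ => Fin q) v b) / wordMass μ v
  have hρpos : ∀ n v b, 0 < ρ n v b := fun n v b => by
    have := hpos _ v
    have := hpos _ (Fin.snoc (α := fun _ => Fin q) v b)
    positivity
  have hρsum : ∀ n v, ∑ b, ρ n v b = q := fun n v => by
    simp only [ρ]
    rw [← Finset.sum_div, ← Finset.mul_sum, sum_wordMass_snoc, mul_div_assoc,
      div_self (hpos _ v).ne', mul_one]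
  let D : ℕ → ℝ := fun n => (∑ v : Fin n → Fin q, ∑ b, Real.log (ρ n v b)) / q ^ (n + 1)
  let A : ℕ → ℝ := fun n => (∑ v : Fin n → Fin q, Real.log (q ^ n * wordMass μ v)) / q ^ n
  have hA : ∀ n, A (n + 1) = A n + D n := fun n => by
    simp only [A, D]
    rw [sum_words_snoc]
    have : ∀ (v : Fin n → Fin q) (b : Fin q), Real.log (q ^ (n + 1) *
        wordMass μ (Fin.snoc (α := fun _ => Fin q) v b)) =
        Real.log (q ^ n * wordMass μ v) + Real.log (ρ n v b) := fun v b => by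
      have := hpos _ v
      rw [← Real.log_mul (by positivity) (hρpos _ _ _).ne']
      congr 1
      simp only [ρ]
      field_simp
      ring
    simp_rw [this, Finset.sum_add_distrib, Finset.sum_const, Finset.card_univ, Fintype.card_fin,
      nsmul_eq_mul, ← Finset.mul_sum]
    field_simp
    ring
  have hAlow : ∀ n, Real.log c ≤ A n := fun n => by
    simp only [A]
    rw [le_div_iff₀ (by positivity)]
    calc Real.log c * q ^ n = ∑ v : Fin n → Fin q, Real.log c := by
          simp [mul_comm]
      _ ≤ _ := by
        refine Finset.sum_le_sum fun v _ => Real.log_le_log hc ?_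
        have := hlow n v
        rw [← div_eq_mul_inv, div_le_iff₀ (by positivity)] at this
        linarith
  have hD : ∀ n, r ≤ n → D (n + 1) = D n := fun n hn => by
    simp only [D]
    rw [sum_words_cons]
    have : ∀ a (v : Fin n → Fin q) b, ρ (n + 1) (Fin.cons (α := fun _ => Fin q) a v) b = ρ n v b :=
      fun a v b => by
        simp only [ρ]
        have h1 := hpos _ v
        have h2 := hpos _ (Fin.cons (α := fun _ => Fin q) a v)
        rw [div_eq_div_iff h2.ne' h1.ne', mul_assoc, hm.wordMass_snoc_cons hs hpos hn]
        ring
    simp_rw [this]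
    rw [Finset.sum_const, Finset.card_univ, Fintype.card_fin, nsmul_eq_mul, pow_succ _ (n + 1)]
    field_simp
  have hDr : ∀ n, r ≤ n → D n = D r := fun n hn => by
    induction n, hn using Nat.le_induction with
    | base => rfl
    | succ n hn ih => rw [hD n hn, ih]
  have hAr : ∀ k : ℕ, A (r + k) = A r + k * D r := fun k => by
    induction k with
    | zero => simp
    | succ k ih => rw [← add_assoc, hA, ih, hDr (r + k) (by omega)]; push_cast; ring
  have hD0 : 0 ≤ D r := by
    by_contra hneg
    push Not at hneg
    obtain ⟨k, hk⟩ := exists_nat_gt ((A r - Real.log c) / (-D r))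
    rw [div_lt_iff₀ (by linarith)] at hk
    have := hAlow (r + k)
    rw [hAr] at this
    linarith
  have hρ1 : ∀ n, r ≤ n → ∀ v b, ρ n v b = 1 := fun n hn => by
    have hDn : 0 ≤ D n := by rw [hDr n hn]; exact hD0
    -- the nonnegative numbers `ρ - 1 - log ρ` have a sum that is not positive, so they all vanish
    have hsum : ∑ v : Fin n → Fin q, ∑ b, (ρ n v b - 1 - Real.log (ρ n v b)) ≤ 0 := by
      simp_rw [Finset.sum_sub_distrib, hρsum]
      simp only [D] at hDn
      rw [le_div_iff₀ (by positivity), zero_mul] at hDn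
      simp only [Finset.sum_const, Finset.card_univ, Fintype.card_fin, mul_one,
        nsmul_eq_mul, sub_self]
      linarith
    have hnn : ∀ v b, 0 ≤ ρ n v b - 1 - Real.log (ρ n v b) := fun v b => by
      have := Real.log_le_sub_one_of_pos (hρpos n v b)
      linarith
    intro v b
    have h0 := (Finset.sum_eq_zero_iff_of_nonneg fun v _ => Finset.sum_nonneg fun b _ =>
      hnn v b).1 (le_antisymm hsum (Finset.sum_nonneg fun v _ => Finset.sum_nonneg fun b _ =>
        hnn v b)) v (Finset.mem_univ v)
    have h1 := (Finset.sum_eq_zero_iff_of_nonneg fun b _ => hnn v b).1 h0 b (Finset.mem_univ b)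
    by_contra hne
    have := Real.log_lt_sub_one_of_pos (hρpos n v b) hne
    linarith
  -- the transition probabilities from words shorter than `r`, by descending induction
  have hstep : ∀ n, ∀ (v : Fin n → Fin q) b,
      q * wordMass μ (Fin.snoc (α := fun _ => Fin q) v b) = wordMass μ v := by
    have hbig : ∀ n, r ≤ n → ∀ (v : Fin n → Fin q) b,
        q * wordMass μ (Fin.snoc (α := fun _ => Fin q) v b) = wordMass μ v := fun n hn v b => by
      have := hρ1 n hn v b
      simp only [ρ] at this
      rwa [div_eq_one_iff_eq (hpos _ v).ne'] at this
    intro n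
    rcases le_total r n with hn | hn
    · exact hbig n hn
    induction hn using Nat.decreasingInduction with
    | self => exact hbig r le_rfl
    | of_succ n hn ih =>
      intro v b
      rw [← sum_wordMass_cons hs, ← sum_wordMass_cons hs v, Finset.mul_sum]
      refine Finset.sum_congr rfl fun a _ => ?_
      rw [Fin.cons_snoc_eq_snoc_cons, ih]
  induction n with
  | zero =>
    have : {s : ℕ → Fin q | ∀ i : Fin 0, s i = w i} = Set.univ := by ext; simp
    rw [wordMass, this]
    simp
  | succ n ih =>
    have h1 := hstep n (Fin.init w) (w (Fin.last n))
    rw [Fin.snoc_init_self, ih] at h1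
    rw [pow_succ, mul_inv, ← h1]
    field_simp

end Uniform

/-! ### Normal sequences -/

section Normal

open Filter Topology

variable {q : ℕ}

/-- The indicator of the sequences that begin with the word `w`. -/
noncomputable def wordIndicator {n : ℕ} (w : Fin n → Fin q) : (ℕ → Fin q) → ℝ :=
  {s | ∀ i : Fin n, s i = w i}.indicator 1

/-- The relative frequency of `w` among the first `m` blocks of the sequence, when it is cut into
consecutive blocks of the length of `w`. For `m = 0` it is `0 / 0 = 0`. -/
noncomputable def blockFreq {n : ℕ} (w : Fin n → Fin q) (m : ℕ) (s : ℕ → Fin q) : ℝ :=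
  (∑ j ∈ Finset.range m, wordIndicator w (dropDigits (j * n) s)) / m

/-- The normal sequences: the frequency of every word `w` among the disjoint blocks of its length
is the one expected under the uniform law. -/
def normalSequences (q : ℕ) : Set (ℕ → Fin q) :=
  {s | ∀ n, ∀ w : Fin n → Fin q, Tendsto (fun m => blockFreq w m s) atTop (𝓝 ((q : ℝ) ^ n)⁻¹)}

lemma measurable_wordIndicator {n : ℕ} (w : Fin n → Fin q) : Measurable (wordIndicator w) :=
  measurable_one.indicator (measurableSet_word w)

lemma wordIndicator_mem {n : ℕ} (w : Fin n → Fin q) (s : ℕ → Fin q) :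
    0 ≤ wordIndicator w s ∧ wordIndicator w s ≤ 1 := by
  unfold wordIndicator Set.indicator
  split_ifs <;> simp

lemma measurable_blockFreq {n : ℕ} (w : Fin n → Fin q) (m : ℕ) : Measurable (blockFreq w m) := by
  unfold blockFreq
  exact (Finset.measurable_sum _ fun j _ =>
    (measurable_wordIndicator w).comp (measurable_dropDigits _)).div_const _

lemma blockFreq_mem {n : ℕ} (w : Fin n → Fin q) (m : ℕ) (s : ℕ → Fin q) :
    0 ≤ blockFreq w m s ∧ blockFreq w m s ≤ 1 := by
  refine ⟨div_nonneg (Finset.sum_nonneg fun j _ => (wordIndicator_mem w _).1) (by positivity),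
    div_le_one_of_le₀ ?_ (by positivity)⟩
  calc _ ≤ ∑ j ∈ Finset.range m, (1 : ℝ) := Finset.sum_le_sum fun j _ => (wordIndicator_mem w _).2
    _ = m := by simp

lemma measurableSet_normalSequences : MeasurableSet (normalSequences q) := by
  unfold normalSequences
  simp_rw [Set.ofPred_forall]
  exact MeasurableSet.iInter fun n => MeasurableSet.iInter fun w =>
    measurableSet_tendsto _ fun m => measurable_blockFreq w m

lemma integral_wordIndicator {n : ℕ} (μ : Measure (ℕ → Fin q)) (w : Fin n → Fin q) :
    ∫ s, wordIndicator w s ∂μ = wordMass μ w :=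
  integral_indicator_one (measurableSet_word w)

/-- A stationary law which charges the normal sequences dominates a positive multiple of the
uniform law on words: the mean frequency of `w` is the mass of `w`, and the normal sequences alone
contribute their mass times `q ^ (-n)` to it in the limit. -/
lemma IsStationaryLaw.le_wordMass {μ : Measure (ℕ → Fin q)} [IsProbabilityMeasure μ]
    (hs : IsStationaryLaw μ) {n : ℕ} (w : Fin n → Fin q) :
    μ.real (normalSequences q) * ((q : ℝ) ^ n)⁻¹ ≤ wordMass μ w := by
  have hlim : Tendsto (fun m => ∫ s in normalSequences q, blockFreq w m s ∂μ) atTop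
      (𝓝 (∫ s in normalSequences q, ((q : ℝ) ^ n)⁻¹ ∂μ)) := by
    refine tendsto_integral_of_dominated_convergence (fun _ => 1)
      (fun m => (measurable_blockFreq w m).aestronglyMeasurable) (integrable_const _)
      (fun m => ae_of_all _ fun s => ?_) ?_
    · rw [Real.norm_of_nonneg (blockFreq_mem w m s).1]
      exact (blockFreq_mem w m s).2
    · exact (ae_restrict_mem measurableSet_normalSequences).mono fun s hs => hs n w
  rw [setIntegral_const, smul_eq_mul] at hlim
  refine le_of_tendsto hlim ((eventually_gt_atTop 0).mono fun m hm => ?_)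
  have hint : Integrable (blockFreq w m) μ := Integrable.of_mem_Icc 0 1
    (measurable_blockFreq w m).aemeasurable (ae_of_all _ fun s => blockFreq_mem w m s)
  refine (setIntegral_le_integral hint (ae_of_all _ fun s => (blockFreq_mem w m s).1)).trans_eq ?_
  unfold blockFreq
  rw [integral_div, integral_finsetSum]
  · have : ∀ j, ∫ s, wordIndicator w (dropDigits (j * n) s) ∂μ = wordMass μ w := fun j => by
      rw [← integral_wordIndicator, ← integral_map (measurable_dropDigits _).aemeasurable
        (measurable_wordIndicator w).aestronglyMeasurable, (hs.measurePreserving _).map_eq]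
    simp_rw [this]
    have : (m : ℝ) ≠ 0 := by positivity
    simp [this]
  · exact fun j _ => Integrable.of_mem_Icc 0 1 ((measurable_wordIndicator w).comp
      (measurable_dropDigits _)).aemeasurable (ae_of_all _ fun s => wordIndicator_mem w _)

/-! ### The uniform law -/

/-- The law of independent digits with the uniform distribution on `Fin q`. -/
noncomputable def uniformLaw (q : ℕ) [NeZero q] : Measure (ℕ → Fin q) :=
  Measure.infinitePi fun _ => (PMF.uniformOfFintype (Fin q)).toMeasure

variable [NeZero q]

instance isProbabilityMeasure_uniformLaw : IsProbabilityMeasure (uniformLaw q) := by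
  unfold uniformLaw; infer_instance

lemma uniformLaw_finset (I : Finset ℕ) (x : ℕ → Fin q) :
    uniformLaw q {s | ∀ i ∈ I, s i = x i} = ((q : ENNReal)⁻¹) ^ I.card := by
  have : {s : ℕ → Fin q | ∀ i ∈ I, s i = x i} = Set.pi (I : Set ℕ) fun i => {x i} := by
    ext s; simp [Set.mem_pi]
  rw [this, uniformLaw, Measure.infinitePi_pi _ fun _ _ => measurableSet_singleton _]
  simp

lemma uniformLaw_preimage_cylinder (k n : ℕ) (x : ℕ → Fin q) :
    uniformLaw q (dropDigits k ⁻¹' PiNat.cylinder x n) = ((q : ENNReal)⁻¹) ^ n := by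
  have : dropDigits k ⁻¹' PiNat.cylinder x n =
      {s : ℕ → Fin q | ∀ i ∈ Finset.Ico k (k + n), s i = x (i - k)} := by
    ext s
    simp only [Set.mem_preimage, PiNat.mem_cylinder_iff, dropDigits, Set.mem_ofPred_eq,
      Finset.mem_Ico]
    refine ⟨fun h i hi => ?_, fun h i hi => ?_⟩
    · rw [← h (i - k) (by omega), Nat.sub_add_cancel hi.1]
    · rw [h (i + k) (by omega), Nat.add_sub_cancel]
  rw [this, uniformLaw_finset _ fun i => x (i - k)]
  simp

lemma uniformLaw_cylinder (n : ℕ) (x : ℕ → Fin q) :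
    uniformLaw q (PiNat.cylinder x n) = ((q : ENNReal)⁻¹) ^ n :=
  uniformLaw_preimage_cylinder 0 n x

lemma isStationaryLaw_uniformLaw : IsStationaryLaw (uniformLaw q) := by
  have : IsProbabilityMeasure ((uniformLaw q).map (dropDigits 1)) :=
    Measure.isProbabilityMeasure_map (measurable_dropDigits 1).aemeasurable
  refine ext_of_cylinder (μ := (uniformLaw q).map (dropDigits 1)) fun x n => ?_
  rw [Measure.map_apply (measurable_dropDigits 1) (measurableSet_cylinder x n),
    uniformLaw_preimage_cylinder, uniformLaw_cylinder]

/-- Under the uniform law, disjoint windows are independent. -/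
lemma indepSet_cylinder {j k n : ℕ} (h : j + n ≤ k) (x : ℕ → Fin q) :
    IndepSet (dropDigits j ⁻¹' PiNat.cylinder x n) (dropDigits k ⁻¹' PiNat.cylinder x n)
      (uniformLaw q) := by
  refine (indepSet_iff_measure_inter_eq_mul (measurable_dropDigits j (measurableSet_cylinder x n))
    (measurable_dropDigits k (measurableSet_cylinder x n)) (uniformLaw q)).2 ?_
  rw [uniformLaw_preimage_cylinder, uniformLaw_preimage_cylinder, ← pow_add]
  have : dropDigits j ⁻¹' PiNat.cylinder x n ∩ dropDigits k ⁻¹' PiNat.cylinder x n =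
      {s : ℕ → Fin q | ∀ i ∈ Finset.Ico j (j + n) ∪ Finset.Ico k (k + n),
        s i = if i < k then x (i - j) else x (i - k)} := by
    ext s
    simp only [Set.mem_inter_iff, Set.mem_preimage, PiNat.mem_cylinder_iff, dropDigits,
      Set.mem_ofPred_eq, Finset.mem_union, Finset.mem_Ico]
    refine ⟨fun ⟨h1, h2⟩ i hi => ?_, fun h' => ⟨fun i hi => ?_, fun i hi => ?_⟩⟩
    · split_ifs with hik
      · rw [← h1 (i - j) (by omega), Nat.sub_add_cancel (by omega)]
      · rw [← h2 (i - k) (by omega), Nat.sub_add_cancel (by omega)]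
    · rw [h' (i + j) (by omega), if_pos (by omega), Nat.add_sub_cancel]
    · rw [h' (i + k) (by omega), if_neg (by omega), Nat.add_sub_cancel]
  rw [this, uniformLaw_finset _ fun i => if i < k then x (i - j) else x (i - k),
    Finset.card_union_of_disjoint]
  · simp
  · rw [Finset.disjoint_left]
    intro i h1 h2
    simp only [Finset.mem_Ico] at h1 h2
    omega

lemma wordMass_uniformLaw {n : ℕ} (w : Fin n → Fin q) :
    wordMass (uniformLaw q) w = ((q : ℝ) ^ n)⁻¹ := by
  obtain ⟨x, hx⟩ := exists_extends (NeZero.pos q) w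
  rw [wordMass_eq_cylinder _ hx, measureReal_def, uniformLaw_cylinder]
  simp

/-- Almost all sequences are normal, by the strong law of large numbers for the disjoint blocks. -/
lemma ae_mem_normalSequences : ∀ᵐ s ∂uniformLaw q, s ∈ normalSequences q := by
  refine ae_all_iff.2 fun n => ae_all_iff.2 fun w => ?_
  obtain ⟨x, hx⟩ := exists_extends (NeZero.pos q) w
  have hcyl : {s : ℕ → Fin q | ∀ i : Fin n, s i = w i} = PiNat.cylinder x n := by
    ext s
    simp only [Set.mem_ofPred_eq, PiNat.mem_cylinder_iff]
    exact ⟨fun hs i hi => by rw [hs ⟨i, hi⟩, ← hx ⟨i, hi⟩], fun hs i => by rw [hs i i.2, hx i]⟩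
  have hmeas : ∀ j, Measurable fun s => wordIndicator w (dropDigits (j * n) s) := fun j =>
    (measurable_wordIndicator w).comp (measurable_dropDigits _)
  have hind : ∀ i j, i < j → IndepFun (fun s => wordIndicator w (dropDigits (i * n) s))
      (fun s => wordIndicator w (dropDigits (j * n) s)) (uniformLaw q) := by
    intro i j hij
    have hset : IndepSet (dropDigits (i * n) ⁻¹' PiNat.cylinder x n)
        (dropDigits (j * n) ⁻¹' PiNat.cylinder x n) (uniformLaw q) :=
      indepSet_cylinder (by nlinarith) x
    have hle : ∀ k, MeasurableSpace.comap (fun s => wordIndicator w (dropDigits (k * n) s))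
        inferInstance ≤
        MeasurableSpace.generateFrom {dropDigits (k * n) ⁻¹' PiNat.cylinder x n} := by
      intro k
      rw [← measurable_iff_comap_le]
      have : (fun s => wordIndicator w (dropDigits (k * n) s)) =
          (dropDigits (k * n) ⁻¹' PiNat.cylinder x n).indicator (fun _ => (1 : ℝ)) := by
        ext s
        rw [wordIndicator, hcyl]
        rfl
      rw [this]
      exact Measurable.indicator (@measurable_const _ _ _ (_) _)
        (MeasurableSpace.measurableSet_generateFrom rfl)
    exact indep_of_indep_of_le hset (hle i) (hle j)
  have h := strong_law_ae_real (μ := uniformLaw q)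
    (fun j s => wordIndicator w (dropDigits (j * n) s))
    (Integrable.of_mem_Icc 0 1 (hmeas 0).aemeasurable (ae_of_all _ fun s => wordIndicator_mem w _))
    (fun i j hij => (lt_or_gt_of_ne hij).elim (hind i j) fun h => (hind j i h).symm)
    (fun j => ⟨(hmeas j).aemeasurable, (hmeas 0).aemeasurable, ?_⟩)
  · have h0 : ∫ s, wordIndicator w (dropDigits (0 * n) s) ∂uniformLaw q = ((q : ℝ) ^ n)⁻¹ := by
      rw [zero_mul, ← wordMass_uniformLaw w, ← integral_wordIndicator]
      rfl
    rw [h0] at h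
    exact h
  · have : ∀ k, (uniformLaw q).map (fun s => wordIndicator w (dropDigits (k * n) s)) =
        (uniformLaw q).map (wordIndicator w) := fun k => by
      conv_rhs => rw [← (isStationaryLaw_uniformLaw.measurePreserving (k * n)).map_eq]
      rw [Measure.map_map (measurable_wordIndicator w) (measurable_dropDigits _)]
      rfl
    rw [this, this]

/-- The dichotomy behind the differentiation theorem: a stationary Markov law is uniform, or the
normal sequences are null for it. -/
lemma IsMarkovLaw.eq_uniformLaw {μ : Measure (ℕ → Fin q)} [IsProbabilityMeasure μ]
    (hs : IsStationaryLaw μ) {r : ℕ} (hm : IsMarkovLaw r μ) (h : μ (normalSequences q) ≠ 0) :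
    μ = uniformLaw q := by
  refine ext_of_cylinder fun x n => ?_
  have hpos : 0 < μ.real (normalSequences q) :=
    measureReal_nonneg.lt_of_ne ((measureReal_ne_zero_iff (by finiteness)).2 h).symm
  have := hm.wordMass_eq_of_le hs (NeZero.pos q) hpos (fun n w => hs.le_wordMass w) n
    (fun i => x i)
  rw [← wordMass_uniformLaw (fun i : Fin n => x i), wordMass_eq_cylinder (x := x) _ fun _ => rfl,
    wordMass_eq_cylinder (x := x) _ fun _ => rfl] at this
  exact (measureReal_eq_measureReal_iff).1 this

end Normal

/-! ### Digits of a uniformly distributed number -/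

section Digits

variable {q : ℕ} [NeZero q]

lemma measurable_digits : Measurable fun x : ℝ => Real.digits x q := by
  refine measurable_pi_iff.2 fun i => ?_
  have : Measurable fun x : ℝ => ⌊x * (q : ℝ) ^ (i + 1)⌋₊ :=
    Nat.measurable_floor.comp (measurable_id.mul_const _)
  exact (Measurable.of_discrete (f := fun k : ℕ => Fin.ofNat q k)).comp this

instance isProbabilityMeasure_restrict_Ico :
    IsProbabilityMeasure (volume.restrict (Set.Ico (0 : ℝ) 1)) := ⟨by simp⟩

/-- The digits of a uniformly distributed number are independent and uniform. The numbers whose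
digits begin with a given word of length `n` lie in an interval of length `q ^ (-n)`; there are
`q ^ n` words and the total mass is `1`, so all these bounds are attained. -/
lemma map_digits_volume (hq : 1 < q) :
    (volume.restrict (Set.Ico (0 : ℝ) 1)).map (fun x => Real.digits x q) = uniformLaw q := by
  set ν := (volume.restrict (Set.Ico (0 : ℝ) 1)).map (fun x => Real.digits x q) with hν
  have hνp : IsProbabilityMeasure ν :=
    Measure.isProbabilityMeasure_map measurable_digits.aemeasurable
  have hle : ∀ n, ∀ w : Fin n → Fin q, wordMass ν w ≤ ((q : ℝ) ^ n)⁻¹ := by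
    intro n w
    rw [wordMass, hν, map_measureReal_apply measurable_digits (measurableSet_word w),
      measureReal_restrict_apply (measurable_digits (measurableSet_word w)), measureReal_def]
    refine ENNReal.toReal_le_of_le_ofReal (by positivity) ((Real.volume_le_diam _).trans ?_)
    refine Metric.ediam_le fun x hx y hy => ?_
    rw [edist_dist]
    refine ENNReal.ofReal_le_ofReal ?_
    rw [Real.dist_eq]
    conv_lhs => rw [← Real.ofDigits_digits hq hx.2, ← Real.ofDigits_digits hq hy.2]
    refine Real.abs_ofDigits_sub_ofDigits_le fun i hi => ?_
    exact (hx.1 ⟨i, hi⟩).trans (hy.1 ⟨i, hi⟩).symm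
  have hq0 : (q : ℝ) ≠ 0 := NeZero.ne _
  have heq : ∀ n, ∀ w : Fin n → Fin q, wordMass ν w = ((q : ℝ) ^ n)⁻¹ := fun n w =>
    (Finset.sum_eq_sum_iff_of_le fun w _ => hle n w).1 (by
      rw [sum_wordMass]
      simp [hq0]) w (Finset.mem_univ w)
  refine ext_of_cylinder fun x n => ?_
  have := heq n (fun i => x i)
  rw [← wordMass_uniformLaw (fun i : Fin n => x i), wordMass_eq_cylinder (x := x) _ fun _ => rfl,
    wordMass_eq_cylinder (x := x) _ fun _ => rfl] at this
  exact (measureReal_eq_measureReal_iff).1 this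

lemma map_ofDigits_uniformLaw (hq : 1 < q) :
    (uniformLaw q).map Real.ofDigits = volume.restrict (Set.Icc (0 : ℝ) 1) := by
  rw [← map_digits_volume hq, Measure.map_map measurable_ofDigits measurable_digits,
    ← Measure.restrict_congr_set (Ico_ae_eq_Icc (a := (0 : ℝ)) (b := 1) (μ := volume))]
  refine (Measure.map_congr ?_).trans Measure.map_id
  filter_upwards [ae_restrict_mem measurableSet_Ico] with x hx
  exact Real.ofDigits_digits hq hx

/-- The only numbers with several expansions are the fractions with a power of `q` as denominator:
if no tail of the expansion `s` has the value `1`, the digits in `s` are the standard ones. -/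
lemma digits_ofDigits_or (s : ℕ → Fin q) :
    Real.digits (Real.ofDigits s) q = s ∨ ∃ n k : ℕ, (q : ℝ) ^ n * Real.ofDigits s = k := by
  have hq0 : (q : ℝ) ≠ 0 := NeZero.ne _
  have hint : ∀ n, ∃ k : ℕ, (q : ℝ) ^ n * ∑ i ∈ Finset.range n, Real.ofDigitsTerm s i = k := by
    intro n
    induction n with
    | zero => exact ⟨0, by simp⟩
    | succ n ih =>
      obtain ⟨k, hk⟩ := ih
      refine ⟨q * k + s n, ?_⟩
      push_cast
      rw [Finset.sum_range_succ, ← hk, Real.ofDigitsTerm]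
      field_simp
      ring
  have hsplit : ∀ n, (q : ℝ) ^ n * Real.ofDigits s = (q : ℝ) ^ n *
      ∑ i ∈ Finset.range n, Real.ofDigitsTerm s i + Real.ofDigits (fun i => s (i + n)) := fun n => by
    rw [Real.ofDigits_eq_sum_add_ofDigits s n]
    field_simp
  by_cases htail : ∃ n, Real.ofDigits (fun i => s (i + n)) = 1
  · right
    obtain ⟨n, hn⟩ := htail
    obtain ⟨k, hk⟩ := hint n
    exact ⟨n, k + 1, by rw [hsplit, hk, hn]; push_cast; rfl⟩
  · left
    push Not at htail
    ext n
    obtain ⟨k, hk⟩ := hint n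
    have hfloor : ⌊Real.ofDigits s * (q : ℝ) ^ (n + 1)⌋₊ = q * k + s n := by
      rw [Nat.floor_eq_iff (mul_nonneg (Real.ofDigits_nonneg s) (by positivity)),
        mul_comm (Real.ofDigits s), hsplit, Finset.sum_range_succ, mul_add, pow_succ', mul_assoc,
        hk, ← pow_succ', Real.ofDigitsTerm, mul_left_comm, mul_inv_cancel₀ (by positivity)]
      have h1 := Real.ofDigits_nonneg fun i => s (i + (n + 1))
      have h2 := (Real.ofDigits_le_one fun i => s (i + (n + 1))).lt_of_ne (htail (n + 1))
      push_cast
      constructor <;> linarith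
    simp only [Real.digits, hfloor, Fin.val_ofNat, Nat.mul_add_mod]
    exact Nat.mod_eq_of_lt (s n).2

/-- The common null set: Lebesgue measure does not charge the numbers which have an expansion that is
not normal. Up to countably many of them, this expansion is the standard one. -/
lemma volume_image_compl_normalSequences (hq : 1 < q) :
    volume (Real.ofDigits '' (normalSequences q)ᶜ) = 0 := by
  have hq0 : (q : ℝ) ≠ 0 := NeZero.ne _
  have hsub : Real.ofDigits '' (normalSequences q)ᶜ ⊆
      ({x | Real.digits x q ∈ (normalSequences q)ᶜ} ∩ Set.Ico 0 1) ∪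
        ⋃ (n : ℕ) (k : ℕ), {x : ℝ | (q : ℝ) ^ n * x = k} := by
    rintro _ ⟨s, hs, rfl⟩
    rcases digits_ofDigits_or s with h | ⟨n, k, h⟩
    · rcases (Real.ofDigits_le_one s).lt_or_eq with h1 | h1
      · exact .inl ⟨by rwa [Set.mem_ofPred_eq, h], Real.ofDigits_nonneg s, h1⟩
      · exact .inr (Set.mem_iUnion₂.2 ⟨0, 1, by simp [h1]⟩)
    · exact .inr (Set.mem_iUnion₂.2 ⟨n, k, h⟩)
  refine measure_mono_null hsub (measure_union_null ?_ ?_)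
  · have hm : MeasurableSet {x : ℝ | Real.digits x q ∈ (normalSequences q)ᶜ} :=
      measurable_digits measurableSet_normalSequences.compl
    rw [← Measure.restrict_apply hm]
    have := ae_mem_normalSequences (q := q)
    rw [← map_digits_volume hq] at this
    exact ae_of_ae_map measurable_digits.aemeasurable this
  · refine measure_iUnion_null fun n => measure_iUnion_null fun k => ?_
    refine Set.Subsingleton.measure_zero (fun x hx y hy => ?_) _
    exact mul_left_cancel₀ (pow_ne_zero n hq0) (Eq.trans hx (Eq.symm hy))

lemma digitCDF_uniformLaw (hq : 1 < q) : digitCDF (uniformLaw q) = uniformCDF := by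
  ext x
  have h : digitCDF (uniformLaw q) x = ((uniformLaw q).map Real.ofDigits).real (Set.Iic x) := by
    rw [map_measureReal_apply measurable_ofDigits measurableSet_Iic]
    rfl
  rw [h, map_ofDigits_uniformLaw hq, measureReal_restrict_apply measurableSet_Iic, measureReal_def,
    Set.inter_comm, ← Set.Ici_inter_Iic, Set.inter_assoc, Set.Iic_inter_Iic, Set.Ici_inter_Iic,
    Real.volume_Icc, uniformCDF, sub_zero, ENNReal.toReal_ofReal', max_comm, min_comm]

/-- A stationary Markov law has the uniform distribution function iff it charges the normal
sequences. -/
lemma digitCDF_eq_uniformCDF_iff (hq : 1 < q) {μ : Measure (ℕ → Fin q)} [IsProbabilityMeasure μ]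
    (hs : IsStationaryLaw μ) {r : ℕ} (hm : IsMarkovLaw r μ) :
    digitCDF μ = uniformCDF ↔ μ (normalSequences q) ≠ 0 := by
  refine ⟨fun h h0 => ?_, fun h => by rw [hm.eq_uniformLaw hs h, digitCDF_uniformLaw hq]⟩
  have hcdf : μ.map Real.ofDigits = volume.restrict (Set.Icc (0 : ℝ) 1) := by
    rw [← map_ofDigits_uniformLaw hq]
    refine Measure.eq_of_cdf _ _ (StieltjesFunction.ext fun x => ?_)
    rw [← digitCDF_eq_cdf, ← digitCDF_eq_cdf, h, digitCDF_uniformLaw hq]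
  have h1 : μ.map Real.ofDigits (Real.ofDigits '' (normalSequences q)ᶜ) = 0 := by
    rw [hcdf]
    exact le_antisymm ((Measure.restrict_apply_le _ _).trans
      (volume_image_compl_normalSequences hq).le) zero_le
  have h2 : μ (normalSequences q)ᶜ = 0 := measure_mono_null (Set.subset_preimage_image _ _)
    (Measure.preimage_null_of_map_null measurable_ofDigits.aemeasurable h1)
  rw [prob_compl_eq_zero_iff measurableSet_normalSequences, h0] at h2
  exact zero_ne_one h2

end Digits

/-! ### Mixtures of laws -/

section Mixture

variable {Ω E : Type*} [MeasurableSpace Ω] [MeasurableSpace E] {P : Measure Ω} {q : ℕ}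
  {X : ℕ → Ω → Fin q} {Z : Ω → E} {κ : Kernel E (ℕ → Fin q)}

/-- The law of the digits is the mixture of their conditional laws. -/
lemma map_digits_apply [IsProbabilityMeasure P] [IsMarkovKernel κ] (hX : ∀ n, Measurable (X n))
    (hZ : Measurable Z)
    (hκ : P.map (fun ω => (Z ω, fun n => X n ω)) = (P.map Z) ⊗ₘ κ) {B : Set (ℕ → Fin q)}
    (hB : MeasurableSet B) : P.map (fun ω n => X n ω) B = ∫⁻ ω, κ (Z ω) B ∂P := by
  have hS : Measurable fun ω n => X n ω := measurable_pi_iff.2 hX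
  have hp : IsProbabilityMeasure (P.map Z) := Measure.isProbabilityMeasure_map hZ.aemeasurable
  have h := congrArg (fun μ => μ (Set.univ ×ˢ B)) hκ
  rw [Measure.map_apply (hZ.prodMk hS) (MeasurableSet.univ.prod hB),
    Measure.compProd_apply_prod MeasurableSet.univ hB, Measure.restrict_univ,
    lintegral_map (κ.measurable_coe hB) hZ] at h
  rw [Measure.map_apply hS hB, ← h]
  congr 1
  ext ω
  simp

/-- The derivative of the distribution function of a mixture of stationary Markov laws. The laws
which charge the normal sequences are uniform; those which do not are all concentrated on the same
Lebesgue null set, the image of the sequences which are not normal, so their mixture is singular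
even though there may be uncountably many of them. -/
lemma ae_hasDerivAt_digitCDF_mixture [NeZero q] (hq : 1 < q) [IsProbabilityMeasure P]
    [IsMarkovKernel κ] (hZ : Measurable Z) {r : ℕ}
    (hMarkov : ∀ᵐ ω ∂P, IsStationaryLaw (κ (Z ω)) ∧ IsMarkovLaw r (κ (Z ω)))
    (ν : Measure (ℕ → Fin q)) [IsProbabilityMeasure ν]
    (hν : ∀ B, MeasurableSet B → ν B = ∫⁻ ω, κ (Z ω) B ∂P) :
    ∀ᵐ x ∂(volume.restrict (Set.Icc (0 : ℝ) 1)),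
      HasDerivAt (digitCDF ν) (P.real (Z ⁻¹' {p | digitCDF (κ p) = uniformCDF})) x := by
  set V : Set Ω := {ω | κ (Z ω) (normalSequences q) ≠ 0} with hV
  have hκm : ∀ {B}, MeasurableSet B → Measurable fun ω => κ (Z ω) B := fun hB =>
    (κ.measurable_coe hB).comp hZ
  have hVm : MeasurableSet V :=
    (hκm measurableSet_normalSequences (measurableSet_singleton 0)).compl
  have hVU : P (Z ⁻¹' {p | digitCDF (κ p) = uniformCDF}) = P V := by
    refine measure_congr ?_
    filter_upwards [hMarkov] with ω hω
    exact propext (digitCDF_eq_uniformCDF_iff hq hω.1 hω.2)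
  -- the part of the mixture which does not charge the normal sequences
  set σ : Measure (ℕ → Fin q) := (P.restrict Vᶜ).bind fun ω => κ (Z ω) with hσ
  have hσB : ∀ B, MeasurableSet B → σ B = ∫⁻ ω in Vᶜ, κ (Z ω) B ∂P := fun B hB =>
    Measure.bind_apply hB (κ.measurable.comp hZ).aemeasurable
  have hσN : σ (normalSequences q) = 0 := by
    rw [hσB _ measurableSet_normalSequences]
    refine (setLIntegral_congr_fun hVm.compl fun ω hω => ?_).trans lintegral_zero
    simpa [hV] using hω
  have hdecomp : ν = σ + P V • uniformLaw q := by
    ext B hB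
    rw [hν B hB, Measure.add_apply, hσB B hB, Measure.smul_apply, smul_eq_mul, add_comm,
      ← lintegral_add_compl _ hVm]
    congr 1
    have : ∀ᵐ ω ∂P, ω ∈ V → κ (Z ω) B = uniformLaw q B := by
      filter_upwards [hMarkov] with ω hω hωV
      rw [hω.2.eq_uniformLaw hω.1 hωV]
    rw [setLIntegral_congr_fun_ae hVm this, setLIntegral_const, mul_comm]
  have hsing : σ.map Real.ofDigits ⟂ₘ volume := by
    set T := toMeasurable volume (Real.ofDigits '' (normalSequences q)ᶜ)
    have hT : MeasurableSet T := measurableSet_toMeasurable _ _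
    refine ⟨Tᶜ, hT.compl, ?_, ?_⟩
    · rw [Measure.map_apply measurable_ofDigits hT.compl]
      refine measure_mono_null (fun s hs => ?_) hσN
      by_contra hN
      exact hs (subset_toMeasurable _ _ ⟨s, hN, rfl⟩)
    · rw [compl_compl, measure_toMeasurable, volume_image_compl_normalSequences hq]
  have hmap : ν.map Real.ofDigits = σ.map Real.ofDigits +
      volume.withDensity ((Set.Icc (0 : ℝ) 1).indicator fun _ => P V) := by
    rw [withDensity_indicator measurableSet_Icc, withDensity_const, hdecomp,
      Measure.map_add _ _ measurable_ofDigits, Measure.map_smul, map_ofDigits_uniformLaw hq]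
  have hrn := Measure.eq_rnDeriv (measurable_const.indicator measurableSet_Icc) hsing hmap
  have hder := (cdf (ν.map Real.ofDigits)).ae_hasDerivAt
  rw [measure_cdf] at hder
  rw [digitCDF_eq_cdf, ae_restrict_iff' measurableSet_Icc]
  filter_upwards [hrn, hder] with x hx1 hx2 hx
  rwa [← hx1, Set.indicator_of_mem hx, ← hVU] at hx2

end Mixture

theorem mainTheorem3 {Ω E : Type*} [MeasurableSpace Ω] [MeasurableSpace E]
    (P : Measure Ω) [IsProbabilityMeasure P]
    (q : ℕ) (hq : 2 ≤ q) (r : ℕ)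
    -- the digits and the random parameter
    (X : ℕ → Ω → Fin q) (hX : ∀ n, Measurable (X n))
    (Z : Ω → E) (hZ : Measurable Z)
    -- `κ p` is the conditional law of the digits given `Z = p`
    (κ : Kernel E (ℕ → Fin q)) [IsMarkovKernel κ]
    (hκ : P.map (fun ω => (Z ω, fun n => X n ω)) = (P.map Z) ⊗ₘ κ)
    -- given `Z`, the digits form a stationary Markov chain of order `r`
    (hMarkov : ∀ᵐ ω ∂P, IsStationaryLaw (κ (Z ω)) ∧ IsMarkovLaw r (κ (Z ω)))
    -- the distribution function of the number with these digits
    (F : ℝ → ℝ) (hF : ∀ x, F x = P.real {ω | Real.ofDigits (fun n => X n ω) ≤ x}) :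
    (∀ x, F x = ∫ ω, digitCDF (κ (Z ω)) x ∂P) ∧
    (∀ x ∈ Set.Icc (0 : ℝ) 1,
      (¬ ContinuousAt F x ↔
        0 < P (Z ⁻¹' {p | ¬ ContinuousAt (digitCDF (κ p)) x}))) ∧
    (∀ x ∈ Set.Icc (0 : ℝ) 1,
      (StrictlyIncreasingAt F x ↔
        0 < P (Z ⁻¹' {p | StrictlyIncreasingAt (digitCDF (κ p)) x}))) ∧
    (∀ᵐ x ∂(volume.restrict (Set.Icc (0 : ℝ) 1)),
      HasDerivAt F (P.real (Z ⁻¹' {p | digitCDF (κ p) = uniformCDF})) x) := by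
  have : NeZero q := ⟨by omega⟩
  have hS : Measurable fun ω n => X n ω := measurable_pi_iff.2 hX
  set ν : Measure (ℕ → Fin q) := P.map fun ω n => X n ω with hν_def
  have hνp : IsProbabilityMeasure ν := Measure.isProbabilityMeasure_map hS.aemeasurable
  have hν : ∀ B, MeasurableSet B → ν B = ∫⁻ ω, κ (Z ω) B ∂P := fun B hB =>
    map_digits_apply hX hZ hκ hB
  have hκm : ∀ {B}, MeasurableSet B → Measurable fun ω => κ (Z ω) B := fun hB =>
    (κ.measurable_coe hB).comp hZ
  have hν0 : ∀ B, MeasurableSet B → (ν B = 0 ↔ ∀ᵐ ω ∂P, κ (Z ω) B = 0) := fun B hB => by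
    rw [hν B hB, lintegral_eq_zero_iff (hκm hB)]
    rfl
  have hle : ∀ x, MeasurableSet {s : ℕ → Fin q | Real.ofDigits s ≤ x} := fun x =>
    measurable_ofDigits measurableSet_Iic
  have hFν : F = digitCDF ν := by
    ext x
    rw [hF, digitCDF, hν_def, map_measureReal_apply hS (hle x)]
    rfl
  subst hFν
  refine ⟨fun x => ?_, fun x _ => ?_, fun x _ => ?_,
    ae_hasDerivAt_digitCDF_mixture (by omega) hZ hMarkov ν hν⟩
  · rw [digitCDF, measureReal_def, hν _ (hle x), ← integral_toReal (hκm (hle x)).aemeasurable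
      (ae_of_all _ fun ω => measure_lt_top _ _)]
    rfl
  · rw [continuousAt_digitCDF_iff, hν0 _ (measurable_ofDigits (measurableSet_singleton x)),
      pos_iff_ne_zero, Ne, not_iff_not, ← compl_mem_ae_iff]
    simp_rw [continuousAt_digitCDF_iff]
    refine Filter.eventually_congr (Filter.Eventually.of_forall fun ω => ?_)
    simp
  · have hball : ∀ k : ℕ, MeasurableSet
        (Real.ofDigits (b := q) ⁻¹' Metric.ball x (1 / (k + 1))) := fun k =>
      measurable_ofDigits Metric.isOpen_ball.measurableSet
    rw [strictlyIncreasingAt_digitCDF_iff, pos_iff_ne_zero]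
    constructor
    · intro h h0
      obtain ⟨K, hK⟩ := exists_ball_null (q := q) r x
      refine h K ((hν0 _ (hball K)).2 ?_)
      filter_upwards [hMarkov, compl_mem_ae_iff.2 h0] with ω hω hωx
      exact hK _ inferInstance hω hωx
    · intro h k hk
      refine h (compl_mem_ae_iff.1 ?_)
      filter_upwards [(hν0 _ (hball k)).1 hk] with ω hω hωx
      exact (strictlyIncreasingAt_digitCDF_iff _ x).1 hωx k hω
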